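/- **Structural characterization of the Gini marginal policy effect.** Let $D$ be a real random variable and let $X$, $\varepsilon$ be random elements (covariates and disturbance) on a probability space, let $m(d,x,e)$ be a real-valued measurable function, continuously differentiable in $d$ for each $(x,e)$, and put $Y=m(D,X,\varepsilon)$. For $t\in[0,1]$ let $\pi_t:\mathbb R\to\mathbb R$ be measurable policy functions with $\pi_0(d)=d$, such that for each $d$ the map $t\mapsto\pi_t(d)$ is continuously differentiable at $t=0$, with derivative $\dot\pi(d)=\partial_t\pi_t(d)|_{t=0}$ bounded in $d$; put $Y^t=m(\pi_t(D),X,\varepsilon)$ and $\dot m(d,x,e)=\partial_t m(\pi_t(d),x,e)|_{t=0}=\dot\pi(d)\,\partial_d m(d,x,e)$. Write $F_Z$ for the CDF and $\operatorname{supp}Z$ for the support of the law of $Z$. Assume: (a) $Y$ has a density $f_Y$; on $\operatorname{supp}Y$ the CDF $F_Y$ is continuously differentiable with derivative $f_Y$ and $0<f_Y<\infty$ (derivatives being taken along $\operatorname{supp}Y$, so one-sided at its end points). (b) $\dot m$ is measurable, and for every $\nu>0$, $\mathbb P\big[|m(\pi_t(D),X,\varepsilon)-m(D,X,\varepsilon)-t\,\dot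 m(D,X,\varepsilon)|\ge \nu t\big]=o(t)$ as $t\downarrow0$. (c) $(Y,\dot m(D,X,\varepsilon))$ has a joint density $f_{Y,\dot m}(y,y')$ that, for each $y'$, is continuous in $y$ on $\operatorname{supp}Y$, and there are a constant $C>0$ and a Lebesgue integrable $g:\mathbb R\to\mathbb R$ with $\int|y'g(y')|\,dy'<\infty$ and $f_{Y,\dot m}(y,y')\le C|g(y')|$ for all $(y,y')$. (d) $\operatorname{supp}Y$ is compact, and there is a compact set $K\subset\mathbb R$ with $\operatorname{supp}Y^t\subseteq K$ for all sufficiently small $t>0$. (e) $\mathbb E[Y]\ne0$. For a CDF $F$ with compact support and nonzero mean let $Q_\tau(F)=\inf\{y:F(y)\ge\tau\}$, $L_p(F)=\int_0^pQ_\tau(F)\,d\tau\big/\int y\,dF(y)$, and $GC(F)=1-2\int_0^1L_p(F)\,dp$. Then $\omega^{GC}(Y,D)\,\partial_dm(D,X,\varepsilon)$ is integrable, the limit defining $$\theta_{GC}:=\lim_{t\downarrow0}\frac{GC(F_{Y^t})-GC(F_Y)}{t}$$ exists, and $$\theta_{GC}=\mathbb E\big[\omega^{GC}(Y,D)\,\partial_dm(D,X,\varepsilon)\big],\qquad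 \omega^{GC}(y,d)=\frac{2\,\varphi(F_Y(y))\,\dot\pi(d)}{\mathbb E[Y]^2},\qquad \varphi(\tau)=\int_0^1(\tau-p)\,Q_p(F_Y)\,dp .$$ -/

import Mathlib

open Set Filter Topology MeasureTheory ProbabilityTheory Asymptotics

namespace GiniMPE

noncomputable section

/-! Functionals of a one-dimensional cumulative distribution function -/

/-- The quantile functional `Q_τ(F) = inf {y : F(y) ≥ τ}`. -/
def quantile (F : StieltjesFunction ℝ) (τ : ℝ) : ℝ := sInf {y : ℝ | τ ≤ F y}

/-- The mean functional `μ(F) = ∫ y dF(y)`. -/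
def mean (F : StieltjesFunction ℝ) : ℝ := ∫ y, y ∂F.measure

/-- The Lorenz curve `L_p(F) = (∫₀ᵖ Q_τ(F) dτ) / ∫ y dF(y)`. -/
def lorenz (F : StieltjesFunction ℝ) (p : ℝ) : ℝ :=
  (∫ τ in (0 : ℝ)..p, quantile F τ) / mean F

/-- The Gini coefficient `GC(F) = 1 - 2 ∫₀¹ L_p(F) dp`. -/
def gini (F : StieltjesFunction ℝ) : ℝ := 1 - 2 * ∫ p in (0 : ℝ)..1, lorenz F p

/-- `φ(τ) = ∫₀¹ (τ - p) Q_p(F) dp`. -/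
def giniPhi (F : StieltjesFunction ℝ) (τ : ℝ) : ℝ :=
  ∫ p in (0 : ℝ)..1, (τ - p) * quantile F p

/-! The nonseparable model -/

section Model

variable {Ω 𝒳 𝓔 : Type*}

/-- The structural derivative `∂_d m(d, x, e)`. -/
def structDeriv (m : ℝ → 𝒳 → 𝓔 → ℝ) (d : ℝ) (x : 𝒳) (e : 𝓔) : ℝ :=
  deriv (fun d' => m d' x e) d

/-- `π̇(d) = ∂_t π_t(d)` at `t = 0`, where the index `t` ranges over `[0, 1]`
(so this is the right derivative). -/
def policyDeriv (π : ℝ → ℝ → ℝ) (d : ℝ) : ℝ :=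
  derivWithin (fun t => π t d) (Icc 0 1) 0

/-- `ṁ(d, x, e) = π̇(d) ∂_d m(d, x, e)`, which is `∂_t m(π_t(d), x, e)` at `t = 0`
(see `StructuralModel.hasDerivWithinAt_mDot`). -/
def mDot (m : ℝ → 𝒳 → 𝓔 → ℝ) (π : ℝ → ℝ → ℝ) (d : ℝ) (x : 𝒳) (e : 𝓔) : ℝ :=
  policyDeriv π d * structDeriv m d x e

/-- The status quo outcome `Y = m(D, X, ε)`. -/
def outcome (m : ℝ → 𝒳 → 𝓔 → ℝ) (D : Ω → ℝ) (X : Ω → 𝒳) (ε : Ω → 𝓔) (ω : Ω) : ℝ :=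
  m (D ω) (X ω) (ε ω)

/-- The counterfactual outcome `Y^t = m(π_t(D), X, ε)`. -/
def cfOutcome (m : ℝ → 𝒳 → 𝓔 → ℝ) (π : ℝ → ℝ → ℝ) (D : Ω → ℝ) (X : Ω → 𝒳) (ε : Ω → 𝓔)
    (t : ℝ) (ω : Ω) : ℝ :=
  m (π t (D ω)) (X ω) (ε ω)

/-- The cumulative distribution function `F_Z` of a random variable `Z`. -/
def cdfOf [MeasurableSpace Ω] (P : Measure Ω) (Z : Ω → ℝ) : StieltjesFunction ℝ :=
  cdf (P.map Z)

/-- The support of (the distribution of) a random variable `Z`. -/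
def supp [MeasurableSpace Ω] (P : Measure Ω) (Z : Ω → ℝ) : Set ℝ := (P.map Z).support

/-- The weight `ω^GC(y, d) = 2 φ(F_Y(y)) π̇(d) / E[Y]²`. -/
def giniWeight [MeasurableSpace Ω] (P : Measure Ω) (π : ℝ → ℝ → ℝ) (Y : Ω → ℝ) (y d : ℝ) : ℝ :=
  2 * giniPhi (cdfOf P Y) (cdfOf P Y y) * policyDeriv π d / (∫ ω, Y ω ∂P) ^ 2

/-- The assumptions on the structural function `m` and on the policy functions `π_t`, `t ∈ [0, 1]`
(values of `π t` for `t` outside `[0, 1]` are irrelevant). -/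
structure StructuralModel [MeasurableSpace 𝒳] [MeasurableSpace 𝓔]
    (m : ℝ → 𝒳 → 𝓔 → ℝ) (π : ℝ → ℝ → ℝ) : Prop where
  /-- `m` is (jointly) measurable. -/
  measurable_m : Measurable (fun z : ℝ × 𝒳 × 𝓔 => m z.1 z.2.1 z.2.2)
  /-- `m(d, x, e)` is continuously differentiable in `d`. -/
  contDiff_m : ∀ x e, ContDiff ℝ 1 (fun d => m d x e)
  /-- Each policy function is measurable, so that `π_t(D)` is a random variable. -/
  measurable_policy : ∀ t ∈ Icc (0 : ℝ) 1, Measurable (π t)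
  /-- `π_0` is the status quo policy. -/
  policy_zero : ∀ d, π 0 d = d
  /-- `π_t(d)` is continuously differentiable in `t` at `t = 0`: it is differentiable in `t`
  near `0`, and the derivative is continuous at `0`. -/
  policy_differentiable : ∀ d, ∀ᶠ t in 𝓝[Icc 0 1] (0 : ℝ),
    DifferentiableWithinAt ℝ (fun s => π s d) (Icc 0 1) t
  policy_deriv_continuous : ∀ d,
    ContinuousWithinAt (derivWithin (fun s => π s d) (Icc 0 1)) (Icc 0 1) 0
  /-- `π̇` is bounded. -/
  policyDeriv_bounded : ∃ B : ℝ, ∀ d, |policyDeriv π d| ≤ B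

theorem StructuralModel.hasDerivWithinAt_mDot [MeasurableSpace 𝒳] [MeasurableSpace 𝓔]
    {m : ℝ → 𝒳 → 𝓔 → ℝ} {π : ℝ → ℝ → ℝ} (h : StructuralModel m π) (d : ℝ) (x : 𝒳) (e : 𝓔) :
    HasDerivWithinAt (fun t => m (π t d) x e) (mDot m π d x e) (Icc 0 1) 0 := by
  have h0 : (0 : ℝ) ∈ Icc (0 : ℝ) 1 := by simp
  have h1 : HasDerivWithinAt (fun t => π t d) (policyDeriv π d) (Icc 0 1) 0 :=
    ((h.policy_differentiable d).self_of_nhdsWithin h0).hasDerivWithinAt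
  have h2 : HasDerivAt (fun d' => m d' x e) (structDeriv m d x e) (π 0 d) := by
    rw [h.policy_zero d]
    exact ((h.contDiff_m x e).differentiable (by norm_num) d).hasDerivAt
  have h3 := h2.comp_hasDerivWithinAt (0 : ℝ) h1
  rw [mul_comm] at h3
  exact h3

/-- The regularity assumptions. -/
structure Regularity [MeasurableSpace Ω] [MeasurableSpace 𝒳] [MeasurableSpace 𝓔]
    (P : Measure Ω) (m : ℝ → 𝒳 → 𝓔 → ℝ) (π : ℝ → ℝ → ℝ)
    (D : Ω → ℝ) (X : Ω → 𝒳) (ε : Ω → 𝓔) : Prop where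
  /-- `F_Y` is continuously differentiable on the support of `Y`, with a density `f_Y` that is
  positive and finite there (one-sided derivatives at end points of the support). -/
  density_outcome : ∃ fY : ℝ → ℝ, Measurable fY ∧
    P.map (outcome m D X ε) = volume.withDensity (fun y => ENNReal.ofReal (fY y)) ∧
    (∀ y ∈ supp P (outcome m D X ε),
      HasDerivWithinAt (fun z => cdfOf P (outcome m D X ε) z) (fY y)
        (supp P (outcome m D X ε)) y) ∧
    ContinuousOn fY (supp P (outcome m D X ε)) ∧
    ∀ y ∈ supp P (outcome m D X ε), 0 < fY y
  /-- `ṁ` is measurable. -/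
  measurable_mDot : Measurable (fun z : ℝ × 𝒳 × 𝓔 => mDot m π z.1 z.2.1 z.2.2)
  /-- `P(|m(π_t(D),X,ε) - m(D,X,ε) - t ṁ(D,X,ε)| ≥ ν t) = o(t)` as `t ↓ 0`, for all `ν > 0`. -/
  remainder : ∀ ν : ℝ, 0 < ν →
    (fun t : ℝ => P.real {ω | ν * t ≤
      |m (π t (D ω)) (X ω) (ε ω) - m (D ω) (X ω) (ε ω) - t * mDot m π (D ω) (X ω) (ε ω)|})
      =o[𝓝[>] 0] (fun t : ℝ => t)
  /-- `(Y, ṁ(D,X,ε))` has a joint density that is continuous in its first argument over the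
  support of `Y` and dominated by `C |g(y')|` with `∫ |g| < ∞` and `∫ |y' g(y')| dy' < ∞`. -/
  density_joint : ∃ f : ℝ → ℝ → ℝ, Measurable (fun z : ℝ × ℝ => f z.1 z.2) ∧
    (∀ y y', 0 ≤ f y y') ∧
    P.map (fun ω => (outcome m D X ε ω, mDot m π (D ω) (X ω) (ε ω)))
      = (volume : Measure (ℝ × ℝ)).withDensity (fun z => ENNReal.ofReal (f z.1 z.2)) ∧
    (∀ y', ContinuousOn (fun y => f y y') (supp P (outcome m D X ε))) ∧
    ∃ g : ℝ → ℝ, Integrable g ∧ Integrable (fun y' => y' * g y') ∧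
      ∃ C : ℝ, 0 < C ∧ ∀ y y', f y y' ≤ C * |g y'|

end Model

end

end GiniMPE

namespace GiniMPE

/-! ### Quantiles of a distribution function carried by a compact interval -/

/-! For a distribution carried by `[a, b]`, the Gini coefficient is `1 - 2 G(F) / μ(F)`, with `G`
the iterated integral of the quantile function. Fubini removes the quantiles: `μ(F) = b - ∫ F` and
`G(F) = b/2 - ∫ (F - F²/2)`, both integrals over `[a, b]`. So `G` is quadratic in `F`, and no
differentiability of the quantile map is needed.

Since `u - u²/2 - (v - v²/2) = (u - v)(1 - (u + v)/2)`, the increment of `G` is the integral of `F_Y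
- F_{Y^t}` against the weight `w_t = 1 - (F_{Y^t} + F_Y)/2`. Integration by parts makes it `E
∫_Y^{Y^t} w_t(y) dy` (`integral_cdfOf_sub_mul`); the increment of `μ` is the same expression with
weight `1`.

Divided by `t`, the inner integral tends pointwise to `(1 - F_Y(Y)) ṁ`. Where the remainder is below
`t`, it is dominated by `|ṁ| + 1`; the complement has probability `o(t)`, while there the quotient
is at most `(b - a)/t` (`tendsto_integral_intervalIntegral_div`). Hence `G' = E[(1 - F_Y(Y)) ṁ]` and
`μ' = E[ṁ]`. The quotient rule and `φ(τ) = G(F_Y) - (1 - τ) E[Y]` (`giniPhi_eq`) give the formula.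
-/

theorem quantile_le_iff {F : StieltjesFunction ℝ} {a b : ℝ} (h0 : ∀ y < a, F y = 0)
    (h1 : F b = 1) {τ : ℝ} (hτ : τ ∈ Ioc (0 : ℝ) 1) (y : ℝ) : quantile F τ ≤ y ↔ τ ≤ F y := by
  -- `τ = 0` has to be excluded: the set would then contain every `y < a`, and `sInf` would return
  -- its default value `0`.
  have hbdd : BddBelow {y : ℝ | τ ≤ F y} := ⟨a, fun z hz => by
    by_contra! h
    have : τ ≤ F z := hz
    rw [h0 z h] at this
    linarith [hτ.1]⟩
  have hne : {y : ℝ | τ ≤ F y}.Nonempty := ⟨b, by simpa [h1] using hτ.2⟩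
  refine ⟨fun h => ?_, fun h => csInf_le hbdd h⟩
  have hgt : ∀ z, y < z → τ ≤ F z := fun z hz => by
    obtain ⟨x, hx, hxz⟩ := exists_lt_of_csInf_lt hne (h.trans_lt hz)
    exact le_trans (show τ ≤ F x from hx) (F.mono hxz.le)
  -- Right continuity shows that the infimum is attained.
  have ht : Tendsto F (𝓝[>] y) (𝓝 (F y)) :=
    (F.right_continuous y).mono_left (nhdsWithin_mono _ Ioi_subset_Ici_self)
  exact ge_of_tendsto ht (eventually_mem_nhdsWithin.mono hgt)

theorem quantile_mem_Icc {F : StieltjesFunction ℝ} {a b : ℝ} (h0 : ∀ y < a, F y = 0)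
    (h1 : F b = 1) {τ : ℝ} (hτ : τ ∈ Ioc (0 : ℝ) 1) : quantile F τ ∈ Icc a b := by
  refine ⟨?_, (quantile_le_iff h0 h1 hτ b).2 (h1 ▸ hτ.2)⟩
  by_contra! h
  have := (quantile_le_iff h0 h1 hτ _).1 le_rfl
  rw [h0 _ h] at this
  linarith [hτ.1]

theorem setIntegral_indicator_Ici_one {a b z : ℝ} (hz : z ∈ Icc a b) :
    ∫ y in Ioc a b, (Ici z).indicator (fun _ => (1 : ℝ)) y = b - z := by
  rw [integral_congr_ae (ae_restrict_of_ae (indicator_ae_eq_of_ae_eq_set Ioi_ae_eq_Ici.symm)),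
    setIntegral_indicator measurableSet_Ioi, Ioc_inter_Ioi, sup_eq_right.2 hz.1]
  simp [hz.2]

/-- By the Galois connection `quantile_le_iff`, the set `τ ≤ F y` is the half-line starting at the
quantile, so its part in `[a, b]` has length `b - Q_τ`. In this form the quantile is ready for
Fubini. -/
theorem quantile_eq_sub_integral {F : StieltjesFunction ℝ} {a b : ℝ} (h0 : ∀ y < a, F y = 0)
    (h1 : F b = 1) {τ : ℝ} (hτ : τ ∈ Ioc (0 : ℝ) 1) :
    quantile F τ = b - ∫ y in Ioc a b, if τ ≤ F y then (1 : ℝ) else 0 := by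
  have h := setIntegral_indicator_Ici_one (quantile_mem_Icc h0 h1 hτ)
  have he : ∀ y, (Ici (quantile F τ)).indicator (fun _ => (1 : ℝ)) y
      = if τ ≤ F y then (1 : ℝ) else 0 := fun y => by
    simp only [indicator, mem_Ici, quantile_le_iff h0 h1 hτ y]
  simp only [he] at h
  linarith

/-- After exchanging the integrals, `τ` runs over `(0, p]` with `τ ≤ F y`, whence the limit `min p
(F y)`. The cases `h = 1` and `h p = τ - p` serve the Lorenz curve and `φ`. -/
theorem intervalIntegral_mul_quantile {F : StieltjesFunction ℝ} {a b : ℝ} (hab : a ≤ b)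
    (h0 : ∀ y < a, F y = 0) (h1 : F b = 1) (hF : ∀ y, 0 ≤ F y) {h : ℝ → ℝ} (hh : Continuous h)
    {p : ℝ} (hp : p ∈ Icc (0 : ℝ) 1) :
    ∫ τ in (0 : ℝ)..p, h τ * quantile F τ
      = b * (∫ τ in (0 : ℝ)..p, h τ) - ∫ y in a..b, ∫ τ in (0 : ℝ)..min p (F y), h τ := by
  have hint : Integrable h (volume.restrict (Ioc 0 p)) :=
    (hh.integrableOn_Icc).mono_set Ioc_subset_Icc_self
  have hprod : Integrable (Function.uncurry fun τ y => h τ * if τ ≤ F y then (1 : ℝ) else 0)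
      ((volume.restrict (Ioc 0 p)).prod (volume.restrict (Ioc a b))) := by
    refine Integrable.mul_bdd (c := 1) (hint.comp_fst _) ?_ (Eventually.of_forall fun z => ?_)
    · refine (Measurable.ite ?_ measurable_const measurable_const).aestronglyMeasurable
      exact measurableSet_le measurable_fst (F.mono.measurable.comp measurable_snd)
    · split_ifs <;> simp
  calc ∫ τ in (0 : ℝ)..p, h τ * quantile F τ
      = ∫ τ in Ioc 0 p, (b * h τ - ∫ y in Ioc a b, h τ * if τ ≤ F y then (1 : ℝ) else 0) := by
        rw [intervalIntegral.integral_of_le hp.1]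
        refine setIntegral_congr_fun measurableSet_Ioc fun τ hτ => ?_
        rw [quantile_eq_sub_integral h0 h1 ⟨hτ.1, hτ.2.trans hp.2⟩, integral_const_mul]
        ring
    _ = b * (∫ τ in Ioc 0 p, h τ)
        - ∫ τ in Ioc 0 p, ∫ y in Ioc a b, h τ * if τ ≤ F y then (1 : ℝ) else 0 := by
        rw [integral_sub (hint.const_mul b) (by exact hprod.integral_prod_left), integral_const_mul]
    _ = _ := by
        rw [integral_integral_swap hprod, intervalIntegral.integral_of_le hp.1,
          intervalIntegral.integral_of_le hab]
        congr 1
        refine setIntegral_congr_fun measurableSet_Ioc fun y _ => ?_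
        rw [intervalIntegral.integral_of_le (le_min hp.1 (hF y)), ← Ioc_inter_Iic,
          ← setIntegral_indicator measurableSet_Iic]
        refine integral_congr_ae (Eventually.of_forall fun τ => ?_)
        simp [indicator]

theorem intervalIntegrable_comp_cdf {F : StieltjesFunction ℝ} (a b : ℝ) {h : ℝ → ℝ}
    (hF : ∀ y, F y ∈ Icc (0 : ℝ) 1) (hh : Continuous h) :
    IntervalIntegrable (fun y => h (F y)) volume a b := by
  obtain ⟨C, hC⟩ := isCompact_Icc.exists_bound_of_continuousOn hh.continuousOn (s := Icc (0 : ℝ) 1)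
  exact (intervalIntegrable_const (c := C)).mono_fun'
    (hh.measurable.comp F.mono.measurable).aestronglyMeasurable
    (Eventually.of_forall fun y => hC _ (hF y))

theorem integral_min_const {c : ℝ} (hc : c ∈ Icc (0 : ℝ) 1) :
    ∫ p in (0 : ℝ)..1, min p c = c - c ^ 2 / 2 := by
  have hi : ∀ u v, IntervalIntegrable (fun p : ℝ => min p c) volume u v := fun u v =>
    (continuous_id.min continuous_const).intervalIntegrable u v
  rw [← intervalIntegral.integral_add_adjacent_intervals (hi 0 c) (hi c 1)]
  have e1 : ∫ p in (0 : ℝ)..c, min p c = ∫ p in (0 : ℝ)..c, p :=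
    intervalIntegral.integral_congr fun p hp => by
      rw [uIcc_of_le hc.1] at hp
      exact min_eq_left hp.2
  have e2 : ∫ p in c..1, min p c = ∫ p in c..1, c :=
    intervalIntegral.integral_congr fun p hp => by
      rw [uIcc_of_le hc.2] at hp
      exact min_eq_right hp.1
  rw [e1, e2]
  simp
  ring

/-- The iterated integral of the quantile function in terms of the distribution function. -/
theorem integral_integral_quantile {F : StieltjesFunction ℝ} {a b : ℝ} (hab : a ≤ b)
    (h0 : ∀ y < a, F y = 0) (h1 : F b = 1) (hF : ∀ y, F y ∈ Icc (0 : ℝ) 1) :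
    ∫ p in (0 : ℝ)..1, ∫ τ in (0 : ℝ)..p, quantile F τ
      = b / 2 - ∫ y in a..b, (F y - F y ^ 2 / 2) := by
  have hprod : Integrable (Function.uncurry fun p y => min p (F y))
      ((volume.restrict (Ioc 0 1)).prod (volume.restrict (Ioc a b))) := by
    refine Integrable.mono' (g := fun z => |z.1| * 1) ?_ ?_ (Eventually.of_forall fun z => ?_)
    · have : Integrable (fun p : ℝ => |p|) (volume.restrict (Ioc (0 : ℝ) 1)) :=
        (continuous_abs.integrableOn_Icc).mono_set Ioc_subset_Icc_self
      exact this.mul_prod (integrable_const (1 : ℝ))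
    · exact (measurable_fst.min (F.mono.measurable.comp measurable_snd)).aestronglyMeasurable
    · have := (hF z.2).1
      simp only [Function.uncurry, Real.norm_eq_abs, mul_one]
      rcases le_total z.1 (F z.2) with h | h
      · rw [min_eq_left h]
      · rw [min_eq_right h, abs_of_nonneg this, abs_of_nonneg (this.trans h)]
        exact h
  have e : ∀ p ∈ Ioc (0 : ℝ) 1, ∫ τ in (0 : ℝ)..p, quantile F τ
      = b * p - ∫ y in Ioc a b, min p (F y) := fun p hp => by
    have := intervalIntegral_mul_quantile hab h0 h1 (fun y => (hF y).1)
      (continuous_const (y := (1 : ℝ))) (Ioc_subset_Icc_self hp)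
    simpa [intervalIntegral.integral_of_le hab] using this
  have hb : Integrable (fun p : ℝ => b * p) (volume.restrict (Ioc (0 : ℝ) 1)) :=
    ((continuous_const.mul continuous_id).integrableOn_Icc).mono_set Ioc_subset_Icc_self
  rw [intervalIntegral.integral_of_le zero_le_one,
    setIntegral_congr_fun measurableSet_Ioc e, integral_sub hb (by exact hprod.integral_prod_left),
    integral_integral_swap hprod, ← intervalIntegral.integral_of_le zero_le_one,
    ← intervalIntegral.integral_of_le hab]
  congr 1
  · rw [intervalIntegral.integral_const_mul, integral_id]
    ring
  · refine intervalIntegral.integral_congr fun y _ => ?_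
    rw [← intervalIntegral.integral_of_le zero_le_one, integral_min_const (hF y)]

/-- `φ(τ)` in terms of the iterated integral of the quantile function and of the mean. -/
theorem giniPhi_eq {F : StieltjesFunction ℝ} {a b : ℝ} (hab : a ≤ b)
    (h0 : ∀ y < a, F y = 0) (h1 : F b = 1) (hF : ∀ y, F y ∈ Icc (0 : ℝ) 1) (τ : ℝ) :
    giniPhi F τ = (∫ p in (0 : ℝ)..1, ∫ τ in (0 : ℝ)..p, quantile F τ)
      - (1 - τ) * (b - ∫ y in a..b, F y) := by
  have hF1 := intervalIntegrable_comp_cdf a b hF continuous_id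
  have hF2 := intervalIntegrable_comp_cdf a b hF ((continuous_pow 2).div_const (2 : ℝ))
  have hτ : ∀ c : ℝ, ∫ p in (0 : ℝ)..c, (τ - p) = τ * c - c ^ 2 / 2 := fun c => by
    rw [intervalIntegral.integral_sub (by simp) (by simp)]
    simp
    ring
  have hmin : ∀ y, min 1 (F y) = F y := fun y => min_eq_right (hF y).2
  rw [integral_integral_quantile hab h0 h1 hF, giniPhi,
    intervalIntegral_mul_quantile hab h0 h1 (fun y => (hF y).1)
      (h := fun p => τ - p) (continuous_const.sub continuous_id) (right_mem_Icc.2 zero_le_one)]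
  simp only [hτ, hmin]
  simp only [id] at hF1
  rw [intervalIntegral.integral_sub hF1 hF2, intervalIntegral.integral_sub (hF1.const_mul τ) hF2,
    intervalIntegral.integral_const_mul]
  ring

theorem gini_eq (F : StieltjesFunction ℝ) :
    gini F = 1 - 2 * ((∫ p in (0 : ℝ)..1, ∫ τ in (0 : ℝ)..p, quantile F τ) / mean F) := by
  simp only [gini, lorenz, intervalIntegral.integral_div]

/-! ### Distribution functions of random variables -/

section RandomVariable

variable {Ω : Type*} [MeasurableSpace Ω] {P : Measure Ω}

theorem cdfOf_apply [IsProbabilityMeasure P] {Z : Ω → ℝ} (hZ : Measurable Z) (y : ℝ) :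
    cdfOf P Z y = P.real {ω | Z ω ≤ y} := by
  have := Measure.isProbabilityMeasure_map (μ := P) hZ.aemeasurable
  rw [cdfOf, cdf_eq_real, map_measureReal_apply hZ measurableSet_Iic]
  rfl

theorem cdfOf_mem_Icc (Z : Ω → ℝ) (y : ℝ) : cdfOf P Z y ∈ Icc (0 : ℝ) 1 :=
  ⟨cdf_nonneg _ y, cdf_le_one _ y⟩

theorem mean_cdfOf [IsProbabilityMeasure P] {Z : Ω → ℝ} (hZ : Measurable Z) : mean (cdfOf P Z) = ∫ ω, Z ω ∂P := by
  have := Measure.isProbabilityMeasure_map (μ := P) hZ.aemeasurable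
  rw [mean, cdfOf, measure_cdf, integral_map (f := fun y => y) hZ.aemeasurable aestronglyMeasurable_id]

theorem cdfOf_eq_zero [IsProbabilityMeasure P] {Z : Ω → ℝ} (hZ : Measurable Z) {a b : ℝ} (h : ∀ᵐ ω ∂P, Z ω ∈ Icc a b) :
    ∀ y < a, cdfOf P Z y = 0 := fun y hy => by
  rw [cdfOf_apply hZ, measureReal_eq_zero_iff, ← compl_mem_ae_iff]
  filter_upwards [h] with ω hω
  simpa using hy.trans_le hω.1

theorem cdfOf_eq_one [IsProbabilityMeasure P] {Z : Ω → ℝ} (hZ : Measurable Z) {a b : ℝ} (h : ∀ᵐ ω ∂P, Z ω ∈ Icc a b) :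
    cdfOf P Z b = 1 := by
  rw [cdfOf_apply hZ, measureReal_def, prob_compl_eq_zero_iff₀ _ |>.1, ENNReal.toReal_one]
  · filter_upwards [h] with ω hω
    simpa using hω.2
  · exact (measurableSet_le hZ measurable_const).nullMeasurableSet

theorem ae_mem_supp {Z : Ω → ℝ} (hZ : Measurable Z) : ∀ᵐ ω ∂P, Z ω ∈ supp P Z :=
  ae_of_ae_map hZ.aemeasurable Measure.support_mem_ae

/-- Integration by parts: integrals against a distribution function as expectations. -/
theorem integral_cdfOf_mul [IsProbabilityMeasure P] {Z : Ω → ℝ} (hZ : Measurable Z) {a b : ℝ} (hab : a ≤ b)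
    (h : ∀ᵐ ω ∂P, Z ω ∈ Icc a b) {w : ℝ → ℝ} (hw : Measurable w) {C : ℝ} (hC : ∀ y, |w y| ≤ C) :
    ∫ y in a..b, cdfOf P Z y * w y = ∫ ω, (∫ y in Z ω..b, w y) ∂P := by
  have hprod : Integrable (Function.uncurry fun y ω => {ω | Z ω ≤ y}.indicator (fun _ => w y) ω)
      ((volume.restrict (Ioc a b)).prod P) := by
    refine Integrable.of_bound (C := C) ?_ (Eventually.of_forall fun z => ?_)
    · refine Measurable.aestronglyMeasurable ?_
      have : (Function.uncurry fun y ω => {ω | Z ω ≤ y}.indicator (fun _ => w y) ω)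
          = {z : ℝ × Ω | Z z.2 ≤ z.1}.indicator fun z => w z.1 := by
        ext z
        simp [indicator, Function.uncurry]
      rw [this]
      exact (hw.comp measurable_fst).indicator
        (measurableSet_le (hZ.comp measurable_snd) measurable_fst)
    · exact (norm_indicator_le_norm_self (fun _ => w z.1) z.2).trans (hC _)
  calc ∫ y in a..b, cdfOf P Z y * w y
      = ∫ y in Ioc a b, ∫ ω, {ω | Z ω ≤ y}.indicator (fun _ => w y) ω ∂P := by
        rw [intervalIntegral.integral_of_le hab]
        refine integral_congr_ae (Eventually.of_forall fun y => ?_)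
        dsimp only
        rw [integral_indicator_const _ (measurableSet_le hZ measurable_const), cdfOf_apply hZ,
          smul_eq_mul]
    _ = ∫ ω, (∫ y in Ioc a b, {ω | Z ω ≤ y}.indicator (fun _ => w y) ω) ∂P :=
        integral_integral_swap hprod
    _ = _ := by
        refine integral_congr_ae (h.mono fun ω hω => ?_)
        dsimp only
        have : ∀ y, {ω | Z ω ≤ y}.indicator (fun _ => w y) ω = (Ici (Z ω)).indicator w y :=
          fun y => by simp [indicator]
        simp only [this]
        rw [integral_congr_ae (ae_restrict_of_ae
          (indicator_ae_eq_of_ae_eq_set Ioi_ae_eq_Ici.symm)),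
          setIntegral_indicator measurableSet_Ioi, Ioc_inter_Ioi, sup_eq_right.2 hω.1,
          intervalIntegral.integral_of_le hω.2]

end RandomVariable

/-! ### First order expansion of integrals between two random variables -/

section Expansion

variable {Ω : Type*} [MeasurableSpace Ω] {P : Measure Ω} [IsProbabilityMeasure P]

theorem intervalIntegrable_of_abs_le_one {w : ℝ → ℝ} (hw : Measurable w) (hw1 : ∀ y, |w y| ≤ 1)
    (u v : ℝ) : IntervalIntegrable w volume u v :=
  (intervalIntegrable_const (c := (1 : ℝ))).mono_fun' hw.aestronglyMeasurable
    (Eventually.of_forall hw1)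

theorem abs_intervalIntegral_le {w : ℝ → ℝ} (hw1 : ∀ y, |w y| ≤ 1) (u v : ℝ) :
    |∫ y in u..v, w y| ≤ |v - u| := by
  simpa using intervalIntegral.norm_integral_le_of_norm_le_const (a := u) (b := v) (f := w)
    (C := 1) fun y _ => hw1 y

theorem measurable_intervalIntegral_comp {w : ℝ → ℝ} (hw : Measurable w) (hw1 : ∀ y, |w y| ≤ 1)
    {U V : Ω → ℝ} (hU : Measurable U) (hV : Measurable V) :
    Measurable fun ω => ∫ y in U ω..V ω, w y := by
  have hi := intervalIntegrable_of_abs_le_one hw hw1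
  have hc := (intervalIntegral.continuous_primitive hi 0).measurable
  have he : ∀ ω, ∫ y in U ω..V ω, w y = (∫ y in (0 : ℝ)..V ω, w y) - ∫ y in (0 : ℝ)..U ω, w y :=
    fun ω => (intervalIntegral.integral_interval_sub_left (hi _ _) (hi _ _)).symm
  simp only [he]
  exact (hc.comp hV).sub (hc.comp hU)

theorem integrable_intervalIntegral_comp {w : ℝ → ℝ} (hw : Measurable w)
    (hw1 : ∀ y, |w y| ≤ 1) {a b : ℝ} {U V : Ω → ℝ} (hU : Measurable U) (hV : Measurable V)
    (hUI : ∀ᵐ ω ∂P, U ω ∈ Icc a b) (hVI : ∀ᵐ ω ∂P, V ω ∈ Icc a b) :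
    Integrable (fun ω => ∫ y in U ω..V ω, w y) P := by
  refine Integrable.of_bound (C := b - a)
    (measurable_intervalIntegral_comp hw hw1 hU hV).aestronglyMeasurable ?_
  filter_upwards [hUI, hVI] with ω h1 h2
  refine (abs_intervalIntegral_le hw1 _ _).trans (abs_le.2 ⟨?_, ?_⟩) <;>
    linarith [h1.1, h1.2, h2.1, h2.2]

/-- A difference of distribution functions, integrated against `w`. -/
theorem integral_cdfOf_sub_mul {w : ℝ → ℝ} (hw : Measurable w)
    (hw1 : ∀ y, |w y| ≤ 1) {a b : ℝ} (hab : a ≤ b) {U V : Ω → ℝ} (hU : Measurable U)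
    (hV : Measurable V) (hUI : ∀ᵐ ω ∂P, U ω ∈ Icc a b) (hVI : ∀ᵐ ω ∂P, V ω ∈ Icc a b) :
    (∫ y in a..b, cdfOf P U y * w y) - ∫ y in a..b, cdfOf P V y * w y
      = ∫ ω, (∫ y in U ω..V ω, w y) ∂P := by
  have hb : ∀ᵐ ω ∂P, (fun _ : Ω => b) ω ∈ Icc a b :=
    Eventually.of_forall fun _ => right_mem_Icc.2 hab
  have hi := intervalIntegrable_of_abs_le_one hw hw1
  rw [integral_cdfOf_mul hU hab hUI hw hw1, integral_cdfOf_mul hV hab hVI hw hw1,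
    ← integral_sub (integrable_intervalIntegral_comp hw hw1 hU measurable_const hUI hb)
      (integrable_intervalIntegral_comp hw hw1 hV measurable_const hVI hb)]
  refine integral_congr_ae (Eventually.of_forall fun ω => ?_)
  dsimp only
  rw [← intervalIntegral.integral_add_adjacent_intervals (hi (U ω) (V ω)) (hi (V ω) b)]
  ring

theorem tendsto_of_tendsto_quotient {y₀ u' : ℝ} {u : ℝ → ℝ}
    (hu : Tendsto (fun t => (u t - y₀) / t) (𝓝[>] 0) (𝓝 u')) : Tendsto u (𝓝[>] 0) (𝓝 y₀) := by
  have ht0 : Tendsto (fun t : ℝ => t) (𝓝[>] 0) (𝓝 0) := nhdsWithin_le_nhds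
  have := (hu.mul ht0).add_const y₀
  rw [mul_zero, zero_add] at this
  refine this.congr' ?_
  filter_upwards [self_mem_nhdsWithin] with t ht
  rw [div_mul_cancel₀ _ (ne_of_gt ht), sub_add_cancel]

/-- Convergence of `w` jointly in `(t, y)` makes the integrand uniformly close to `w₀ y₀` on the
shrinking interval from `y₀` to `u t`, so the integral is `w₀ y₀ (u t - y₀)` up to `o(t)`. -/
theorem tendsto_intervalIntegral_div {w : ℝ → ℝ → ℝ} {w₀ : ℝ → ℝ}
    (hw : ∀ t, Measurable (w t)) (hw1 : ∀ t y, |w t y| ≤ 1)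
    {y₀ : ℝ} (hlim : Tendsto (fun q : ℝ × ℝ => w q.1 q.2) (𝓝[>] 0 ×ˢ 𝓝 y₀) (𝓝 (w₀ y₀)))
    {u : ℝ → ℝ} {u' : ℝ} (hu : Tendsto (fun t => (u t - y₀) / t) (𝓝[>] 0) (𝓝 u')) :
    Tendsto (fun t => (∫ y in y₀..u t, w t y) / t) (𝓝[>] 0) (𝓝 (w₀ y₀ * u')) := by
  have huy : Tendsto (fun t => u t - y₀) (𝓝[>] 0) (𝓝 0) :=
    tendsto_sub_nhds_zero_iff.2 (tendsto_of_tendsto_quotient hu)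
  have hdiff : Tendsto (fun t => (∫ y in y₀..u t, (w t y - w₀ y₀)) / t) (𝓝[>] 0) (𝓝 0) := by
    rw [Metric.tendsto_nhds]
    intro η hη
    obtain ⟨δ, hδ, hδη⟩ : ∃ δ > 0, δ * (|u'| + 1) < η := by
      refine ⟨η / 2 / (|u'| + 1), by positivity, ?_⟩
      rw [div_mul_cancel₀ _ (by positivity)]
      linarith
    obtain ⟨p, hp, q, hq, hpq⟩ := eventually_prod_iff.1 (Metric.tendsto_nhds.1 hlim δ hδ)
    obtain ⟨r, hr, hrq⟩ := Metric.eventually_nhds_iff.1 hq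
    filter_upwards [hp, self_mem_nhdsWithin, Metric.tendsto_nhds.1 huy r hr,
      hu.abs.eventually_lt_const (lt_add_one |u'|)] with t htp ht0 htr htu
    have ht : (0 : ℝ) < t := ht0
    rw [Real.dist_0_eq_abs, abs_div, abs_of_pos ht]
    rw [Real.dist_0_eq_abs] at htr
    rw [abs_div, abs_of_pos ht] at htu
    have hb : |∫ y in y₀..u t, (w t y - w₀ y₀)| ≤ δ * |u t - y₀| := by
      refine intervalIntegral.norm_integral_le_of_norm_le_const
        (f := fun y => w t y - w₀ y₀) fun y hy => ?_
      have hy' : |y - y₀| ≤ |u t - y₀| := abs_sub_left_of_mem_uIcc (uIoc_subset_uIcc hy)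
      exact (hpq htp (hrq (by simpa [Real.dist_eq] using hy'.trans_lt htr))).le
    calc |∫ y in y₀..u t, (w t y - w₀ y₀)| / t ≤ δ * |u t - y₀| / t := by gcongr
      _ = δ * (|u t - y₀| / t) := by ring
      _ ≤ δ * (|u'| + 1) := by gcongr
      _ < η := hδη
  have := hdiff.add (hu.const_mul (w₀ y₀))
  rw [zero_add] at this
  refine this.congr fun t => ?_
  rw [intervalIntegral.integral_sub (intervalIntegrable_of_abs_le_one (hw t) (hw1 t) _ _)
    (by simp), intervalIntegral.integral_const, smul_eq_mul]
  ring

variable {Y : Ω → ℝ} {Yt : ℝ → Ω → ℝ} {M : Ω → ℝ} {a b : ℝ}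

/-- Joint convergence of distribution functions at a point that is not an atom of the limit. -/
theorem tendsto_cdfOf (hY : Measurable Y) (hYt : ∀ᶠ t in 𝓝[>] (0 : ℝ), Measurable (Yt t))
    (hlim : ∀ ω, Tendsto (fun t => Yt t ω) (𝓝[>] 0) (𝓝 (Y ω))) {y : ℝ}
    (hatom : ∀ᵐ ω ∂P, Y ω ≠ y) :
    Tendsto (fun q : ℝ × ℝ => cdfOf P (Yt q.1) q.2) (𝓝[>] 0 ×ˢ 𝓝 y) (𝓝 (cdfOf P Y y)) := by
  have key : Tendsto (fun q : ℝ × ℝ => ∫ ω, {ω | Yt q.1 ω ≤ q.2}.indicator (fun _ => (1 : ℝ)) ω ∂P)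
      (𝓝[>] 0 ×ˢ 𝓝 y) (𝓝 (∫ ω, {ω | Y ω ≤ y}.indicator (fun _ => (1 : ℝ)) ω ∂P)) := by
    refine tendsto_integral_filter_of_dominated_convergence (fun _ => (1 : ℝ)) ?_ ?_
      (integrable_const _) ?_
    · filter_upwards [tendsto_fst.eventually hYt] with q hq
      exact (measurable_const.indicator
        (measurableSet_le hq measurable_const)).aestronglyMeasurable
    · refine Eventually.of_forall fun q => Eventually.of_forall fun ω => ?_
      exact (norm_indicator_le_norm_self _ _).trans (by simp)
    -- Off the event `Y = y`, the comparison of `Yt` with a nearby level is eventually that of `Y`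
    -- with `y`.
    · filter_upwards [hatom] with ω hω
      have h1 : Tendsto (fun q : ℝ × ℝ => Yt q.1 ω) (𝓝[>] 0 ×ˢ 𝓝 y) (𝓝 (Y ω)) :=
        (hlim ω).comp tendsto_fst
      have h2 : Tendsto (fun q : ℝ × ℝ => q.2) (𝓝[>] (0 : ℝ) ×ˢ 𝓝 y) (𝓝 y) := tendsto_snd
      refine tendsto_const_nhds.congr' ?_
      rcases lt_or_gt_of_ne hω with h | h
      · filter_upwards [h1.eventually_lt h2 h] with q hq
        simp [indicator, hq.le, h.le]
      · filter_upwards [h2.eventually_lt h1 h] with q hq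
        simp [indicator, not_le.2 hq, not_le.2 h]
  rw [cdfOf_apply hY, ← integral_indicator_one (measurableSet_le hY measurable_const)]
  refine key.congr' ?_
  filter_upwards [tendsto_fst.eventually hYt] with q hq
  rw [cdfOf_apply hq, ← integral_indicator_one (measurableSet_le hq measurable_const)]
  rfl

/-- Differentiation under the expectation, when the remainder is controlled in probability and the
random variables are bounded. -/
theorem tendsto_integral_intervalIntegral_div (hY : Measurable Y)
    (hYt : ∀ᶠ t in 𝓝[>] (0 : ℝ), Measurable (Yt t)) (hMm : Measurable M) (hM : Integrable M P)
    (hlim : ∀ ω, Tendsto (fun t => (Yt t ω - Y ω) / t) (𝓝[>] 0) (𝓝 (M ω)))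
    (hrem : (fun t : ℝ => P.real {ω | t ≤ |Yt t ω - Y ω - t * M ω|}) =o[𝓝[>] 0] fun t : ℝ => t)
    (hYI : ∀ᵐ ω ∂P, Y ω ∈ Icc a b) (hYtI : ∀ᶠ t in 𝓝[>] (0 : ℝ), ∀ᵐ ω ∂P, Yt t ω ∈ Icc a b)
    {w : ℝ → ℝ → ℝ} {w₀ : ℝ → ℝ} (hw : ∀ t, Measurable (w t)) (hw1 : ∀ t y, |w t y| ≤ 1)
    (hw0 : ∀ y, Tendsto (fun q : ℝ × ℝ => w q.1 q.2) (𝓝[>] 0 ×ˢ 𝓝 y) (𝓝 (w₀ y))) :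
    Tendsto (fun t => (∫ ω, (∫ y in Y ω..Yt t ω, w t y) ∂P) / t) (𝓝[>] 0)
      (𝓝 (∫ ω, w₀ (Y ω) * M ω ∂P)) := by
  set A : ℝ → Set Ω := fun t => {ω | t ≤ |Yt t ω - Y ω - t * M ω|} with hA
  set Z : ℝ → Ω → ℝ := fun t ω => (∫ y in Y ω..Yt t ω, w t y) / t with hZ
  have hAm : ∀ᶠ t in 𝓝[>] (0 : ℝ), MeasurableSet (A t) := hYt.mono fun t ht =>
    measurableSet_le measurable_const ((ht.sub hY).sub (hMm.const_mul t)).abs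
  have hZm : ∀ᶠ t in 𝓝[>] (0 : ℝ), Measurable (Z t) := hYt.mono fun t ht =>
    (measurable_intervalIntegral_comp (hw t) (hw1 t) hY ht).div_const t
  have hZabs : ∀ t, 0 < t → ∀ ω, |Z t ω| ≤ |Yt t ω - Y ω| / t := fun t ht ω => by
    rw [hZ]
    dsimp only
    rw [abs_div, abs_of_pos ht]
    exact div_le_div_of_nonneg_right (abs_intervalIntegral_le (hw1 t) _ _) ht.le
  have hgood : Tendsto (fun t => ∫ ω, (A t)ᶜ.indicator (Z t) ω ∂P) (𝓝[>] 0)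
      (𝓝 (∫ ω, w₀ (Y ω) * M ω ∂P)) := by
    refine tendsto_integral_filter_of_dominated_convergence (fun ω => |M ω| + 1) ?_ ?_
      (hM.abs.add (integrable_const _)) (Eventually.of_forall fun ω => ?_)
    · filter_upwards [hAm, hZm] with t h1 h2
      exact (h2.indicator h1.compl).aestronglyMeasurable
    · filter_upwards [self_mem_nhdsWithin] with t ht0
      have ht : (0 : ℝ) < t := ht0
      refine Eventually.of_forall fun ω => ?_
      by_cases hω : ω ∈ (A t)ᶜ
      · rw [indicator_of_mem hω]
        have hlt : |Yt t ω - Y ω - t * M ω| < t := not_le.1 hω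
        refine (hZabs t ht ω).trans ?_
        rw [div_le_iff₀ ht]
        calc |Yt t ω - Y ω| = |(Yt t ω - Y ω - t * M ω) + t * M ω| := by ring_nf
          _ ≤ |Yt t ω - Y ω - t * M ω| + |t * M ω| := abs_add_le _ _
          _ ≤ t + t * |M ω| := by rw [abs_mul, abs_of_pos ht]; gcongr
          _ = (|M ω| + 1) * t := by ring
      · rw [indicator_of_notMem hω, norm_zero]
        positivity
    -- For fixed `ω` the remainder divided by `t` tends to `0`, so `ω` eventually lies outside `A
    -- t`.
    · refine (tendsto_intervalIntegral_div hw hw1 (hw0 (Y ω)) (hlim ω)).congr' ?_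
      have h1 := Metric.tendsto_nhds.1 (hlim ω) 1 one_pos
      filter_upwards [h1, self_mem_nhdsWithin] with t ht1 ht0
      have ht : (0 : ℝ) < t := ht0
      have hω : ω ∈ (A t)ᶜ := by
        change ¬ t ≤ |Yt t ω - Y ω - t * M ω|
        refine not_le.2 ?_
        rw [Real.dist_eq] at ht1
        have : Yt t ω - Y ω - t * M ω = t * ((Yt t ω - Y ω) / t - M ω) := by
          field_simp
        rw [this, abs_mul, abs_of_pos ht]
        exact (mul_lt_mul_of_pos_left ht1 ht).trans_eq (mul_one t)
      rw [indicator_of_mem hω]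
  -- The quotient is at most `(b - a) / t`, exactly compensated by `P (A t) = o(t)`.
  have hbad : Tendsto (fun t => ∫ ω, (A t).indicator (Z t) ω ∂P) (𝓝[>] 0) (𝓝 0) := by
    have h0 := (hrem.tendsto_div_nhds_zero).const_mul (b - a)
    rw [mul_zero] at h0
    refine squeeze_zero_norm' ?_ h0
    filter_upwards [hAm, hYtI, self_mem_nhdsWithin] with t h1 h2 ht0
    have ht : (0 : ℝ) < t := ht0
    rw [integral_indicator h1]
    have := norm_setIntegral_le_of_norm_le_const_ae (μ := P) (s := A t) (f := Z t)
      (C := (b - a) / t) (measure_lt_top _ _) (ae_restrict_of_ae ?_)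
    · refine this.trans_eq ?_
      ring
    · filter_upwards [hYI, h2] with ω h3 h4
      refine (hZabs t ht ω).trans ?_
      gcongr
      exact abs_le.2 ⟨by linarith [h3.1, h3.2, h4.1, h4.2], by linarith [h3.1, h3.2, h4.1, h4.2]⟩
  have hsum := hgood.add hbad
  rw [add_zero] at hsum
  refine hsum.congr' ?_
  filter_upwards [hAm, hYt, hYtI] with t h1 h2 h3
  have hi : Integrable (Z t) P :=
    (integrable_intervalIntegral_comp (hw t) (hw1 t) hY h2 hYI h3).div_const t
  rw [← integral_add (hi.indicator h1.compl) (hi.indicator h1), ← integral_div]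
  refine integral_congr_ae (Eventually.of_forall fun ω => ?_)
  exact congrFun (indicator_compl_add_self (A t) (Z t)) ω

/-- The derivative of the Gini coefficient along a path of bounded random variables. -/
theorem tendsto_gini_div (hab : a ≤ b) (hY : Measurable Y)
    (hYt : ∀ᶠ t in 𝓝[>] (0 : ℝ), Measurable (Yt t)) (hMm : Measurable M) (hM : Integrable M P)
    (hlim : ∀ ω, Tendsto (fun t => (Yt t ω - Y ω) / t) (𝓝[>] 0) (𝓝 (M ω)))
    (hrem : (fun t : ℝ => P.real {ω | t ≤ |Yt t ω - Y ω - t * M ω|}) =o[𝓝[>] 0] fun t : ℝ => t)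
    (hYI : ∀ᵐ ω ∂P, Y ω ∈ Icc a b) (hYtI : ∀ᶠ t in 𝓝[>] (0 : ℝ), ∀ᵐ ω ∂P, Yt t ω ∈ Icc a b)
    (hatom : ∀ y, ∀ᵐ ω ∂P, Y ω ≠ y) (hmean : ∫ ω, Y ω ∂P ≠ 0) :
    Integrable (fun ω => 2 * giniPhi (cdfOf P Y) (cdfOf P Y (Y ω)) / (∫ ω, Y ω ∂P) ^ 2 * M ω) P ∧
    Tendsto (fun t => (gini (cdfOf P (Yt t)) - gini (cdfOf P Y)) / t) (𝓝[>] 0)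
      (𝓝 (∫ ω, 2 * giniPhi (cdfOf P Y) (cdfOf P Y (Y ω)) / (∫ ω, Y ω ∂P) ^ 2 * M ω ∂P)) := by
  set F := cdfOf P Y with hF
  set μ := ∫ ω, Y ω ∂P with hμ
  let G : StieltjesFunction ℝ → ℝ := fun F => ∫ p in (0 : ℝ)..1, ∫ τ in (0 : ℝ)..p, quantile F τ
  have hmeanEq : ∀ {Z : Ω → ℝ}, Measurable Z → (∀ᵐ ω ∂P, Z ω ∈ Icc a b) →
      mean (cdfOf P Z) = b - ∫ y in a..b, cdfOf P Z y := fun {Z} hZ hZI => by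
    have h1 := integral_cdfOf_mul hZ hab hZI measurable_const (w := fun _ => 1) (C := 1) (by simp)
    have h2 : Integrable Z P := Integrable.of_mem_Icc a b hZ.aemeasurable hZI
    simp only [mul_one, intervalIntegral.integral_const, smul_eq_mul] at h1
    rw [mean_cdfOf hZ, h1, integral_sub (integrable_const _) h2]
    simp
  have hGEq : ∀ {Z : Ω → ℝ}, Measurable Z → (∀ᵐ ω ∂P, Z ω ∈ Icc a b) →
      G (cdfOf P Z) = b / 2 - ∫ y in a..b, (cdfOf P Z y - cdfOf P Z y ^ 2 / 2) :=
    fun {Z} hZ hZI => integral_integral_quantile hab (cdfOf_eq_zero hZ hZI)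
      (cdfOf_eq_one hZ hZI) (cdfOf_mem_Icc Z)
  -- The secant slope of `s ↦ s - s²/2` between the two values of the distribution functions.
  let w : ℝ → ℝ → ℝ := fun t y => 1 - (cdfOf P (Yt t) y + F y) / 2
  have hwm : ∀ t, Measurable (w t) := fun t => measurable_const.sub
    (((cdfOf P (Yt t)).mono.measurable.add F.mono.measurable).div_const 2)
  have hw1 : ∀ t y, |w t y| ≤ 1 := fun t y => by
    have h1 := cdfOf_mem_Icc (P := P) (Yt t) y
    have h2 := cdfOf_mem_Icc (P := P) Y y
    rw [abs_le]
    constructor <;> simp only [w] <;> linarith [h1.1, h1.2, h2.1, h2.2]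
  have hw0 : ∀ y, Tendsto (fun q : ℝ × ℝ => w q.1 q.2) (𝓝[>] 0 ×ˢ 𝓝 y) (𝓝 (1 - F y)) := by
    intro y
    have h1 := tendsto_cdfOf hY hYt (fun ω => tendsto_of_tendsto_quotient (hlim ω)) (hatom y)
    -- The constant path gives continuity of `F` at `y`.
    have h2 := tendsto_cdfOf (Yt := fun _ => Y) hY (Eventually.of_forall fun _ => hY)
      (fun ω => tendsto_const_nhds) (hatom y)
    have h3 := ((h1.add h2).div_const 2).const_sub 1
    rwa [add_self_div_two] at h3
  have hGlim := tendsto_integral_intervalIntegral_div hY hYt hMm hM hlim hrem hYI hYtI hwm hw1 hw0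
  have hμlim := tendsto_integral_intervalIntegral_div hY hYt hMm hM hlim hrem hYI hYtI
    (w := fun _ _ => 1) (w₀ := fun _ => 1) (fun _ => measurable_const) (by simp)
    (fun _ => tendsto_const_nhds)
  have hGdiff : ∀ᶠ t in 𝓝[>] (0 : ℝ),
      ∫ ω, (∫ y in Y ω..Yt t ω, w t y) ∂P = G (cdfOf P (Yt t)) - G F := by
    filter_upwards [hYt, hYtI] with t h1 h2
    have hi : ∀ Z : Ω → ℝ, IntervalIntegrable (fun y => cdfOf P Z y * w t y) volume a b :=
      fun Z => intervalIntegrable_of_abs_le_one ((cdfOf P Z).mono.measurable.mul (hwm t))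
        (fun y => by
          rw [Pi.mul_apply, abs_mul, abs_of_nonneg (cdfOf_mem_Icc Z y).1]
          exact mul_le_one₀ (cdfOf_mem_Icc Z y).2 (abs_nonneg _) (hw1 t y)) a b
    have hq : ∀ Z : Ω → ℝ, IntervalIntegrable
        (fun y => cdfOf P Z y - cdfOf P Z y ^ 2 / 2) volume a b :=
      fun Z => intervalIntegrable_comp_cdf (h := fun s => s - s ^ 2 / 2) a b (cdfOf_mem_Icc Z)
        (by fun_prop)
    rw [← integral_cdfOf_sub_mul (hwm t) (hw1 t) hab hY h1 hYI h2, hGEq h1 h2, hF, hGEq hY hYI,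
      sub_sub_sub_cancel_left, ← intervalIntegral.integral_sub (hi _) (hi _),
      ← intervalIntegral.integral_sub (hq _) (hq _)]
    refine intervalIntegral.integral_congr fun y _ => ?_
    simp only [w, hF]
    ring
  have hμdiff : ∀ᶠ t in 𝓝[>] (0 : ℝ),
      ∫ ω, (∫ y in Y ω..Yt t ω, (1 : ℝ)) ∂P = mean (cdfOf P (Yt t)) - μ := by
    filter_upwards [hYt, hYtI] with t h1 h2
    have i1 : Integrable Y P := Integrable.of_mem_Icc a b hY.aemeasurable hYI
    have i2 : Integrable (Yt t) P := Integrable.of_mem_Icc a b h1.aemeasurable h2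
    rw [mean_cdfOf h1, hμ, ← integral_sub i2 i1]
    simp
  have hG' : Tendsto (fun t => (G (cdfOf P (Yt t)) - G F) / t) (𝓝[>] 0)
      (𝓝 (∫ ω, (1 - F (Y ω)) * M ω ∂P)) :=
    hGlim.congr' (hGdiff.mono fun t ht => by rw [ht])
  have hμ' : Tendsto (fun t => (mean (cdfOf P (Yt t)) - μ) / t) (𝓝[>] 0)
      (𝓝 (∫ ω, M ω ∂P)) := by
    simp only [one_mul] at hμlim
    exact hμlim.congr' (hμdiff.mono fun t ht => by rw [ht])
  have hμt : Tendsto (fun t => mean (cdfOf P (Yt t))) (𝓝[>] 0) (𝓝 μ) :=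
    tendsto_of_tendsto_quotient hμ'
  have hphi : ∀ τ, giniPhi F τ = G F - (1 - τ) * μ := fun τ => by
    rw [giniPhi_eq hab (cdfOf_eq_zero hY hYI) (cdfOf_eq_one hY hYI) (cdfOf_mem_Icc Y),
      ← hmeanEq hY hYI, mean_cdfOf hY]
  have hFM : Integrable (fun ω => (1 - F (Y ω)) * M ω) P := by
    refine hM.bdd_mul (c := 1)
      (measurable_const.sub (F.mono.measurable.comp hY)).aestronglyMeasurable
      (Eventually.of_forall fun ω => ?_)
    have h2 := cdfOf_mem_Icc (P := P) Y (Y ω)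
    rw [Real.norm_eq_abs, abs_le]
    constructor <;> linarith [h2.1, h2.2]
  have hform : (fun ω => 2 * giniPhi F (F (Y ω)) / μ ^ 2 * M ω)
      = fun ω => (2 * G F / μ ^ 2) * M ω - (2 * μ / μ ^ 2) * ((1 - F (Y ω)) * M ω) := by
    ext ω
    rw [hphi]
    ring
  rw [hform]
  refine ⟨(hM.const_mul _).sub (hFM.const_mul _), ?_⟩
  rw [integral_sub (hM.const_mul _) (hFM.const_mul _), integral_const_mul, integral_const_mul]
  have hfin := (((hμ'.const_mul (G F)).sub (hG'.const_mul μ)).const_mul 2).div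
    (hμt.mul_const μ) (mul_ne_zero hmean hmean)
  have hval : 2 * G F / μ ^ 2 * (∫ ω, M ω ∂P) - 2 * μ / μ ^ 2 * ∫ ω, (1 - F (Y ω)) * M ω ∂P
      = 2 * (G F * (∫ ω, M ω ∂P) - μ * ∫ ω, (1 - F (Y ω)) * M ω ∂P) / (μ * μ) := by ring
  rw [hval]
  refine hfin.congr' ?_
  filter_upwards [hμt.eventually_ne hmean, self_mem_nhdsWithin] with t h1 ht0
  have ht : t ≠ 0 := ne_of_gt ht0
  rw [gini_eq, gini_eq, hF, mean_cdfOf hY, ← hF, ← hμ]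
  change _ = (1 - 2 * (G (cdfOf P (Yt t)) / _) - (1 - 2 * (G F / μ))) / t
  rw [Pi.div_apply]
  field_simp
  ring

end Expansion

/-! ### Consequences of the model assumptions -/

section Regularity

variable {Ω 𝒳 𝓔 : Type*} [MeasurableSpace 𝒳] [MeasurableSpace 𝓔]
  {m : ℝ → 𝒳 → 𝓔 → ℝ} {π : ℝ → ℝ → ℝ} {D : Ω → ℝ} {X : Ω → 𝒳} {ε : Ω → 𝓔}

theorem StructuralModel.tendsto_cfOutcome_quotient (hS : StructuralModel m π) (ω : Ω) :
    Tendsto (fun t => (cfOutcome m π D X ε t ω - outcome m D X ε ω) / t) (𝓝[>] 0)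
      (𝓝 (mDot m π (D ω) (X ω) (ε ω))) := by
  have h := (hasDerivWithinAt_iff_tendsto_slope.1
    (hS.hasDerivWithinAt_mDot (D ω) (X ω) (ε ω))).mono_left (nhdsWithin_mono 0
      (fun t (ht : t ∈ Ioo (0 : ℝ) 1) => ⟨Ioo_subset_Icc_self ht, ne_of_gt ht.1⟩))
  rw [nhdsWithin_Ioo_eq_nhdsGT zero_lt_one] at h
  refine h.congr fun t => ?_
  simp [slope_def_field, cfOutcome, outcome, hS.policy_zero]

variable [MeasurableSpace Ω] {P : Measure Ω}

theorem StructuralModel.measurable_cfOutcome (hS : StructuralModel m π) (hD : Measurable D)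
    (hX : Measurable X) (hε : Measurable ε) {t : ℝ} (ht : t ∈ Icc (0 : ℝ) 1) :
    Measurable (cfOutcome m π D X ε t) :=
  hS.measurable_m.comp (((hS.measurable_policy t ht).comp hD).prodMk (hX.prodMk hε))

theorem Regularity.ae_outcome_ne (hR : Regularity P m π D X ε)
    (hY : Measurable (outcome m D X ε)) (y : ℝ) : ∀ᵐ ω ∂P, outcome m D X ε ω ≠ y := by
  obtain ⟨fY, -, hf, -⟩ := hR.density_outcome
  refine ae_of_ae_map hY.aemeasurable (p := fun z => z ≠ y) ?_
  rw [hf]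
  exact (withDensity_absolutelyContinuous _ _).ae_le (Measure.ae_ne volume y)

/-- The dominated joint density gives `E|ṁ| ≤ vol(supp Y) · C ∫ |y' g(y')| dy'`, and compactness
makes the volume finite. -/
theorem Regularity.integrable_mDot (hR : Regularity P m π D X ε)
    (hD : Measurable D) (hX : Measurable X) (hε : Measurable ε)
    (hY : Measurable (outcome m D X ε)) (hc : IsCompact (supp P (outcome m D X ε))) :
    Integrable (fun ω => mDot m π (D ω) (X ω) (ε ω)) P := by
  obtain ⟨f, hfm, -, hf, -, g, -, hg, C, -, hfg⟩ := hR.density_joint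
  have hM : Measurable fun ω => mDot m π (D ω) (X ω) (ε ω) :=
    hR.measurable_mDot.comp (hD.prodMk (hX.prodMk hε))
  set S := supp P (outcome m D X ε) with hS
  have hSm : MeasurableSet S := hc.isClosed.measurableSet
  refine ⟨hM.aestronglyMeasurable, ?_⟩
  have hind : Measurable fun z : ℝ × ℝ => (Prod.fst ⁻¹' S).indicator (fun z => ‖z.2‖ₑ) z :=
    (measurable_snd.enorm).indicator (measurable_fst hSm)
  have hbound : Integrable (fun y' => C * |y' * g y'|) := hg.abs.const_mul C
  calc ∫⁻ ω, ‖mDot m π (D ω) (X ω) (ε ω)‖ₑ ∂P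
      = ∫⁻ ω, (Prod.fst ⁻¹' S).indicator (fun z => ‖z.2‖ₑ)
          (outcome m D X ε ω, mDot m π (D ω) (X ω) (ε ω)) ∂P := by
        refine lintegral_congr_ae ((ae_mem_supp hY).mono fun ω hω => ?_)
        dsimp only
        rw [indicator_of_mem (show _ ∈ Prod.fst ⁻¹' S from hω)]
    _ = ∫⁻ z : ℝ × ℝ, ENNReal.ofReal (f z.1 z.2)
          * (Prod.fst ⁻¹' S).indicator (fun z => ‖z.2‖ₑ) z := by
        rw [← lintegral_map hind (hY.prodMk hM), hf,
          lintegral_withDensity_eq_lintegral_mul _ hfm.ennreal_ofReal hind]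
        rfl
    _ ≤ ∫⁻ z : ℝ × ℝ, S.indicator 1 z.1 * ‖C * |z.2 * g z.2|‖ₑ := by
        refine lintegral_mono fun z => ?_
        by_cases hz : z.1 ∈ S
        · rw [indicator_of_mem (show z ∈ Prod.fst ⁻¹' S from hz), indicator_of_mem hz,
            Pi.one_apply, one_mul, Real.enorm_eq_ofReal_abs, ← ENNReal.ofReal_mul' (abs_nonneg _)]
          refine (ENNReal.ofReal_le_ofReal ?_).trans (Real.ofReal_le_enorm _)
          rw [abs_mul]
          calc f z.1 z.2 * |z.2| ≤ C * |g z.2| * |z.2| := by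
                gcongr
                exact hfg _ _
            _ = C * (|z.2| * |g z.2|) := by ring
        · rw [indicator_of_notMem (show z ∉ Prod.fst ⁻¹' S from hz), mul_zero]
          exact zero_le
    _ = volume S * ∫⁻ y', ‖C * |y' * g y'|‖ₑ := by
        rw [Measure.volume_eq_prod, lintegral_prod_mul
          (measurable_one.indicator hSm).aemeasurable hbound.aestronglyMeasurable.enorm,
          lintegral_indicator_one hSm]
    _ < ⊤ := ENNReal.mul_lt_top hc.measure_lt_top hbound.2

end Regularity

end GiniMPE

/-! ### The Gini marginal policy effect -/

theorem corollaryS {Ω 𝒳 𝓔 : Type*} [MeasurableSpace Ω] [MeasurableSpace 𝒳] [MeasurableSpace 𝓔]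
    (P : Measure Ω) [IsProbabilityMeasure P]
    (m : ℝ → 𝒳 → 𝓔 → ℝ) (π : ℝ → ℝ → ℝ)
    (D : Ω → ℝ) (X : Ω → 𝒳) (ε : Ω → 𝓔)
    (hD : Measurable D) (hX : Measurable X) (hε : Measurable ε)
    (Y : Ω → ℝ) (hY : Y = GiniMPE.outcome m D X ε)
    (hS : GiniMPE.StructuralModel m π)
    (hR : GiniMPE.Regularity P m π D X ε)
    (hcompact : IsCompact (GiniMPE.supp P Y))
    (hcompact' : ∃ K : Set ℝ, IsCompact K ∧
      ∀ᶠ t in 𝓝[>] (0 : ℝ), GiniMPE.supp P (GiniMPE.cfOutcome m π D X ε t) ⊆ K)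
    (hmean : ∫ ω, Y ω ∂P ≠ 0) :
    Integrable (fun ω => GiniMPE.giniWeight P π Y (Y ω) (D ω) *
      GiniMPE.structDeriv m (D ω) (X ω) (ε ω)) P ∧
    Tendsto (fun t : ℝ =>
        (GiniMPE.gini (GiniMPE.cdfOf P (GiniMPE.cfOutcome m π D X ε t)) -
          GiniMPE.gini (GiniMPE.cdfOf P Y)) / t)
      (𝓝[>] 0)
      (𝓝 (∫ ω, GiniMPE.giniWeight P π Y (Y ω) (D ω) *
        GiniMPE.structDeriv m (D ω) (X ω) (ε ω) ∂P)) := by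
  subst hY
  obtain ⟨K, hK, hKt⟩ := hcompact'
  have hYm : Measurable (GiniMPE.outcome m D X ε) :=
    hS.measurable_m.comp (hD.prodMk (hX.prodMk hε))
  have hYt : ∀ᶠ t in 𝓝[>] (0 : ℝ), Measurable (GiniMPE.cfOutcome m π D X ε t) := by
    filter_upwards [Ioo_mem_nhdsGT (zero_lt_one' ℝ)] with t ht
    exact hS.measurable_cfOutcome hD hX hε (Ioo_subset_Icc_self ht)
  -- One interval must carry `Y` and all `Y^t` with small `t`, since the formulas for `G` and `μ`
  -- depend on `a` and `b`.
  obtain ⟨r, hr⟩ := (hcompact.union hK).isBounded.subset_closedBall 0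
  rw [Real.closedBall_eq_Icc] at hr
  have hYI := (GiniMPE.ae_mem_supp (P := P) hYm).mono fun ω hω => hr (Or.inl hω)
  have hYtI : ∀ᶠ t in 𝓝[>] (0 : ℝ), ∀ᵐ ω ∂P,
      GiniMPE.cfOutcome m π D X ε t ω ∈ Icc (0 - r) (0 + r) := by
    filter_upwards [hYt, hKt] with t h1 h2
    exact (GiniMPE.ae_mem_supp h1).mono fun ω hω => hr (Or.inr (h2 hω))
  have hab : 0 - r ≤ 0 + r := by
    obtain ⟨ω, hω⟩ := hYI.exists
    exact hω.1.trans hω.2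
  -- The single level `ν = 1` suffices: the remainder bound supplies only domination, and pointwise
  -- convergence comes from differentiability.
  have hrem := hR.remainder 1 one_pos
  simp only [one_mul] at hrem
  have h := GiniMPE.tendsto_gini_div hab hYm hYt
    (hR.measurable_mDot.comp (hD.prodMk (hX.prodMk hε)))
    (hR.integrable_mDot hD hX hε hYm hcompact)
    hS.tendsto_cfOutcome_quotient hrem hYI hYtI (hR.ae_outcome_ne hYm) hmean
  have hw : ∀ ω, GiniMPE.giniWeight P π (GiniMPE.outcome m D X ε) (GiniMPE.outcome m D X ε ω) (D ω)
      * GiniMPE.structDeriv m (D ω) (X ω) (ε ω)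
      = 2 * GiniMPE.giniPhi (GiniMPE.cdfOf P (GiniMPE.outcome m D X ε))
          (GiniMPE.cdfOf P (GiniMPE.outcome m D X ε) (GiniMPE.outcome m D X ε ω))
        / (∫ ω, GiniMPE.outcome m D X ε ω ∂P) ^ 2 * GiniMPE.mDot m π (D ω) (X ω) (ε ω) := fun ω => by
    simp only [GiniMPE.giniWeight, GiniMPE.mDot]
    ring
  simp only [hw]
  exact h
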